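/- Let $\mathcal V$ be a finite set of qubit variables, $\mathcal H=\bigotimes_{q\in\mathcal V}\mathbb C^2$, and let $\sqsubseteq$ be the Löwner order. A *state* is a positive operator $\rho$ on $\mathcal H$ with $\operatorname{tr}\rho\le 1$; a *quantum predicate* is an operator $M$ on $\mathcal H$ with $0\sqsubseteq M\sqsubseteq I$; an *assertion* is a nonempty set of quantum predicates. Operations on predicates are extended to assertions element-wise, and a single predicate $M$ also stands for $\{M\}$. For a tuple $\bar q=q_1,\dots,q_n$ of distinct variables, a subscript $\bar q$ marks the action of an operator on these qubits (tensored with the identity on the others), and $|i\rangle$, $0\le i<2^n$, is their computational basis. *Programs* are given by $$S::=\mathbf{skip}\mid\mathbf{abort}\mid\bar q:=0\mid\bar q\mathrel{*\!=}U\mid S_0;S_1\mid S_0\,\square\,S_1\mid\mathbf{if}\ \mathcal M[\bar q]\ \mathbf{then}\ S_1\ \mathbf{else}\ S_0\ \mathbf{end}\mid\mathbf{while}\ \mathcal M[\bar q]\ \mathbf{do}\ S\ \mathbf{end},$$ with $U$ unitary and $\mathcal M=\{P^0,P^1\}$ a two-outcome projective measurement on $\mathcal H_{\bar q}$. Put $\mathcal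 P^b_{\bar q}(A)=P^b_{\bar q}AP^b_{\bar q}$. The denotation $[\![S]\!]$ is a set of super-operators on $\mathcal H$: - $[\![\mathbf{skip}]\!]=\{\mathcal I\}$, $[\![\mathbf{abort}]\!]=\{0\}$, $[\![\bar q:=0]\!]=\{\rho\mapsto\sum_i|0\rangle_{\bar q}\langle i|\,\rho\,|i\rangle_{\bar q}\langle 0|\}$, $[\![\bar q\mathrel{*\!=}U]\!]=\{\rho\mapsto U_{\bar q}\rho U_{\bar q}^\dagger\}$; - $[\![S_0;S_1]\!]=\{\mathcal F\circ\mathcal E:\mathcal E\in[\![S_0]\!],\mathcal F\in[\![S_1]\!]\}$ and $[\![S_0\,\square\,S_1]\!]=[\![S_0]\!]\cup[\![S_1]\!]$; - $[\![\mathbf{if}\ \mathcal M[\bar q]\ \mathbf{then}\ S_1\ \mathbf{else}\ S_0\ \mathbf{end}]\!]=\{\mathcal E\circ\mathcal P^0_{\bar q}+\mathcal F\circ\mathcal P^1_{\bar q}:\mathcal E\in[\![S_0]\!],\mathcal F\in[\![S_1]\!]\}$; - $[\![\mathbf{while}\ \mathcal M[\bar q]\ \mathbf{do}\ S\ \mathbf{end}]\!]=\{\sum_{i=0}^\infty\mathcal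 P^0_{\bar q}\circ\eta_i\circ\mathcal P^1_{\bar q}\circ\cdots\circ\eta_1\circ\mathcal P^1_{\bar q}:\eta_1,\eta_2,\ldots\in[\![S]\!]\}$. Let $\mathrm{Exp}(\rho\models\Theta)=\inf_{M\in\Theta}\operatorname{tr}(M\rho)$, and write $\Theta\le_{\mathit{inf}}\Psi$ if $\mathrm{Exp}(\rho\models\Theta)\le\mathrm{Exp}(\rho\models\Psi)$ for every state $\rho$. The formula $\{\Theta\}S\{\Psi\}$ is *true in the sense of partial correctness*, $\models_{par}\{\Theta\}S\{\Psi\}$, if for every state $\rho$ $$\mathrm{Exp}(\rho\models\Theta)\le\inf\{\mathrm{Exp}(\mathcal E(\rho)\models\Psi)+\operatorname{tr}\rho-\operatorname{tr}\mathcal E(\rho):\mathcal E\in[\![S]\!]\}.$$ Let $\vdash_{par}$ be derivability from the following axioms and rules (all assertions $\Theta,\Psi,\dots$ arbitrary): - (Skip) $\{\Theta\}\,\mathbf{skip}\,\{\Theta\}$; (Abort) $\{I\}\,\mathbf{abort}\,\{0\}$; - (Init) $\{\sum_i|i\rangle_{\bar q}\langle 0|\,\Theta\,|0\rangle_{\bar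 q}\langle i|\}\ \bar q:=0\ \{\Theta\}$; (Unit) $\{U_{\bar q}^\dagger\Theta U_{\bar q}\}\ \bar q\mathrel{*\!=}U\ \{\Theta\}$; - (Seq) from $\{\Theta\}S_0\{\Theta'\}$ and $\{\Theta'\}S_1\{\Psi\}$ infer $\{\Theta\}S_0;S_1\{\Psi\}$; - (NDet) from $\{\Theta\}S_0\{\Psi\}$ and $\{\Theta\}S_1\{\Psi\}$ infer $\{\Theta\}S_0\,\square\,S_1\{\Psi\}$; - (Meas) from $\{\Theta_1\}S_1\{\Psi\}$ and $\{\Theta_0\}S_0\{\Psi\}$ infer $\{\mathcal P^0_{\bar q}(\Theta_0)+\mathcal P^1_{\bar q}(\Theta_1)\}\ \mathbf{if}\ \mathcal M[\bar q]\ \mathbf{then}\ S_1\ \mathbf{else}\ S_0\ \mathbf{end}\ \{\Psi\}$; - (While) from $\{\Theta\}S\{\mathcal P^0_{\bar q}(\Psi)+\mathcal P^1_{\bar q}(\Theta)\}$ infer $\{\mathcal P^0_{\bar q}(\Psi)+\mathcal P^1_{\bar q}(\Theta)\}\ \mathbf{while}\ \mathcal M[\bar q]\ \mathbf{do}\ S\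 \mathbf{end}\ \{\Psi\}$; - (Imp) from $\Theta\le_{\mathit{inf}}\Theta'$, $\{\Theta'\}S\{\Psi'\}$ and $\Psi'\le_{\mathit{inf}}\Psi$ infer $\{\Theta\}S\{\Psi\}$; - (Union) from $\{\Theta_i\}S\{\Psi_i\}$ for all $i$ in a nonempty index set $I$ infer $\{\bigcup_{i\in I}\Theta_i\}S\{\bigcup_{i\in I}\Psi_i\}$. **Theorem.** The proof system is sound and relatively complete for partial correctness: for every program $S$ and all assertions $\Theta,\Psi$, $$\vdash_{par}\{\Theta\}S\{\Psi\}\iff\ \models_{par}\{\Theta\}S\{\Psi\}.$$ -/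

import Mathlib

open scoped Kronecker ComplexOrder

universe u

namespace NQP

/-! ### Operators on a system of qubits -/

/-- Bit strings indexed by `ι`; they label the computational basis of the tensor product of
one copy of `ℂ²` for each element of `ι`. -/
abbrev Bits (ι : Type u) : Type u := ι → Fin 2

/-- Linear operators on the state space of the qubits `ι`, as matrices in the computational
basis. -/
abbrev Op (ι : Type u) : Type u := Matrix (Bits ι) (Bits ι) ℂ

variable {V : Type u} [Fintype V] [DecidableEq V]

/-- Splitting a bit string on `V` into its part on the distinct variables `q 0, …, q (n-1)`
and its part on the remaining variables. -/
noncomputable def split {n : ℕ} (q : Fin n ↪ V) :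
    Bits V ≃ Bits (Fin n) × Bits {v : V // ¬ v ∈ Set.range q} :=
  (Equiv.piEquivPiSubtypeProd (fun v : V => v ∈ Set.range q) (fun _ => Fin 2)).trans
    (Equiv.prodCongr
      (Equiv.arrowCongr (Equiv.ofInjective q q.injective).symm (Equiv.refl (Fin 2)))
      (Equiv.refl _))

/-- The operator `A` acting on the tuple `q` of qubits: the cylinder extension `A ⊗ I`. -/
noncomputable def embed {n : ℕ} (q : Fin n ↪ V) (A : Op (Fin n)) : Op V :=
  (A ⊗ₖ (1 : Op {v : V // ¬ v ∈ Set.range q})).submatrix (split q) (split q)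

theorem embed_mul {n : ℕ} (q : Fin n ↪ V) (A B : Op (Fin n)) :
    embed q (A * B) = embed q A * embed q B := by
  simp only [embed, Matrix.submatrix_mul_equiv, ← Matrix.mul_kronecker_mul, mul_one]

theorem embed_one {n : ℕ} (q : Fin n ↪ V) : embed q 1 = 1 := by
  simp [embed]

theorem embed_conjTranspose {n : ℕ} (q : Fin n ↪ V) (A : Op (Fin n)) :
    (embed q A).conjTranspose = embed q A.conjTranspose := by
  simp [embed, Matrix.conjTranspose_submatrix, Matrix.conjTranspose_kronecker]

theorem embed_sum {n : ℕ} {ι : Type*} (q : Fin n ↪ V) (s : Finset ι) (A : ι → Op (Fin n)) :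
    embed q (∑ i ∈ s, A i) = ∑ i ∈ s, embed q (A i) := by
  ext x y
  simp [embed, Matrix.sum_apply, Finset.sum_mul]

/-- The outer product `|x⟩⟨y|` of two computational basis vectors of `n` qubits. -/
def ketbra {n : ℕ} (x y : Bits (Fin n)) : Op (Fin n) := Matrix.single x y 1

/-- A two-outcome projective measurement on `n` qubits. -/
structure Measurement (n : ℕ) where
  /-- the projectors for the outcomes `0` and `1` -/
  P : Fin 2 → Op (Fin n)
  isHermitian : ∀ b, (P b).IsHermitian
  idempotent : ∀ b, P b * P b = P b
  complete : P 0 + P 1 = 1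

/-! ### Syntax -/

/-- Nondeterministic quantum while-programs over the quantum variables `V`. -/
inductive Prog (V : Type u) : Type u
  | skip : Prog V
  | abort : Prog V
  /-- `q := 0` -/
  | setZero {n : ℕ} (q : Fin n ↪ V) : Prog V
  /-- `q *= U` -/
  | unitary {n : ℕ} (q : Fin n ↪ V) (U : Matrix.unitaryGroup (Bits (Fin n)) ℂ) : Prog V
  /-- `S₀; S₁` -/
  | seq (S₀ S₁ : Prog V) : Prog V
  /-- `S₀ □ S₁` -/
  | choice (S₀ S₁ : Prog V) : Prog V
  /-- `if M[q] then S₁ else S₀ end` -/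
  | cond {n : ℕ} (M : Measurement n) (q : Fin n ↪ V) (S₁ S₀ : Prog V) : Prog V
  /-- `while M[q] do S end` -/
  | loop {n : ℕ} (M : Measurement n) (q : Fin n ↪ V) (S : Prog V) : Prog V

/-! ### Denotational semantics -/

/-- Linear maps on operators. -/
abbrev SuperOp (V : Type u) [Fintype V] [DecidableEq V] : Type u := Op V →ₗ[ℂ] Op V

/-- The super-operator `ρ ↦ K ρ K†`. -/
noncomputable def conjBy (K : Op V) : SuperOp V where
  toFun ρ := K * ρ * K.conjTranspose
  map_add' ρ σ := by simp [mul_add, add_mul]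
  map_smul' c ρ := by simp

/-- The super-operator `ρ ↦ ∑ᵢ |0⟩⟨i| ρ |i⟩⟨0|` on `q`. -/
noncomputable def setZeroOp {n : ℕ} (q : Fin n ↪ V) : SuperOp V :=
  ∑ i : Bits (Fin n), conjBy (embed q (ketbra 0 i))

/-- The super-operator `ρ ↦ P ρ P` with `P` the projector for the outcome `b` on `q`. -/
noncomputable def measOp {n : ℕ} (M : Measurement n) (q : Fin n ↪ V) (b : Fin 2) : SuperOp V :=
  conjBy (embed q (M.P b))

/-- `k` rounds of a loop under the scheduler `η`: `η (k-1) ∘ 𝒫¹ ∘ ⋯ ∘ η 0 ∘ 𝒫¹`. -/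
noncomputable def rounds {n : ℕ} (M : Measurement n) (q : Fin n ↪ V) (η : ℕ → SuperOp V) : ℕ → SuperOp V
  | 0 => LinearMap.id
  | k + 1 => η k ∘ₗ measOp M q 1 ∘ₗ rounds M q η k

/-- The lifted denotational semantics: the set of super-operators denoted by a program, on the
state space of all variables. In the case of a loop, the super-operator given by a scheduler
`η` is the sum of the series `∑ₖ 𝒫⁰ ∘ η (k-1) ∘ 𝒫¹ ∘ ⋯ ∘ η 0 ∘ 𝒫¹`. -/
def sem : Prog V → Set (SuperOp V)
  | .skip => {LinearMap.id}
  | .abort => {0}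
  | .setZero q => {setZeroOp q}
  | .unitary q U => {conjBy (embed q (U : Op (Fin _)))}
  | .seq S₀ S₁ => {G | ∃ E ∈ sem S₀, ∃ F ∈ sem S₁, G = F ∘ₗ E}
  | .choice S₀ S₁ => sem S₀ ∪ sem S₁
  | .cond M q S₁ S₀ =>
      {G | ∃ E ∈ sem S₀, ∃ F ∈ sem S₁, G = E ∘ₗ measOp M q 0 + F ∘ₗ measOp M q 1}
  | .loop M q S =>
      {G | ∃ η : ℕ → SuperOp V, (∀ k, η k ∈ sem S) ∧
        ∀ ρ : Op V, HasSum (fun k => measOp M q 0 (rounds M q η k ρ)) (G ρ)}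

/-! ### Predicates, assertions and correctness -/

/-- Partial density operators: positive operators of trace at most `1`. -/
def IsState (ρ : Op V) : Prop := ρ.PosSemidef ∧ ρ.trace.re ≤ 1

/-- Quantum predicates: operators `M` with `0 ⊑ M ⊑ I` in the Löwner order. -/
abbrev Predicate (V : Type u) [Fintype V] [DecidableEq V] : Type u :=
  {M : Op V // M.PosSemidef ∧ (1 - M).PosSemidef}

/-- Quantum assertions: nonempty sets of quantum predicates. -/
abbrev Assertion (V : Type u) [Fintype V] [DecidableEq V] : Type u :=
  {Θ : Set (Predicate V) // Θ.Nonempty}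

/-- `Exp(ρ ⊨ Θ) = inf {tr(Mρ) : M ∈ Θ}`. -/
noncomputable def expect (ρ : Op V) (Θ : Assertion V) : ℝ :=
  ⨅ M : Θ.1, ((M.1.1 : Op V) * ρ).trace.re

/-- The pre-order `≤_inf` on assertions. -/
def leInf (Θ Ψ : Assertion V) : Prop :=
  ∀ ρ : Op V, IsState ρ → expect ρ Θ ≤ expect ρ Ψ

/-- Truth of the correctness formula `{Θ} S {Ψ}` in the sense of partial correctness. -/
def PartiallyCorrect (Θ : Assertion V) (S : Prog V) (Ψ : Assertion V) : Prop :=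
  ∀ ρ : Op V, IsState ρ →
    expect ρ Θ ≤
      sInf {r : ℝ | ∃ σ ∈ (fun E : SuperOp V => E ρ) '' sem S,
        r = expect σ Ψ + ρ.trace.re - σ.trace.re}

/-! ### Operations on predicates and assertions used in the proof rules -/

theorem isPredicate_sum {ι : Type*} [Fintype ι] (K : ι → Op V)
    (hK : ∑ i, (K i).conjTranspose * K i = 1) (M : ι → Predicate V) :
    (∑ i, (K i).conjTranspose * (M i).1 * K i).PosSemidef ∧
      (1 - ∑ i, (K i).conjTranspose * (M i).1 * K i).PosSemidef := by
  refine ⟨Matrix.posSemidef_sum _ fun i _ => (M i).2.1.conjTranspose_mul_mul_same _, ?_⟩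
  have h : 1 - ∑ i, (K i).conjTranspose * (M i).1 * K i
      = ∑ i, (K i).conjTranspose * (1 - (M i).1) * K i := by
    simp only [mul_sub, sub_mul, mul_one, Finset.sum_sub_distrib, hK]
  rw [h]
  exact Matrix.posSemidef_sum _ fun i _ => (M i).2.2.conjTranspose_mul_mul_same _

/-- The predicate `I`. -/
def Predicate.top : Predicate V := ⟨1, Matrix.PosSemidef.one, by simp [Matrix.PosSemidef.zero]⟩

/-- The predicate `0`. -/
def Predicate.bot : Predicate V := ⟨0, Matrix.PosSemidef.zero, by simp [Matrix.PosSemidef.one]⟩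

/-- `∑ᵢ |i⟩⟨0| M |0⟩⟨i|` on `q`. -/
noncomputable def Predicate.preSetZero {n : ℕ} (q : Fin n ↪ V) (M : Predicate V) : Predicate V :=
  ⟨∑ i : Bits (Fin n), embed q (ketbra i 0) * M.1 * embed q (ketbra 0 i), by
    have hadj : ∀ i : Bits (Fin n),
        embed q (ketbra i 0) = (embed q (ketbra 0 i)).conjTranspose := fun i => by
      simp [embed_conjTranspose, ketbra, Matrix.conjTranspose_single]
    simp only [hadj]
    refine isPredicate_sum (fun i => embed q (ketbra 0 i)) ?_ (fun _ => M)
    simp only [← hadj, ← embed_mul, ← embed_sum]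
    rw [← embed_one q]
    congr 1
    simp [ketbra, Matrix.sum_single_one]⟩

/-- `U† M U` on `q`. -/
noncomputable def Predicate.preUnitary {n : ℕ} (q : Fin n ↪ V) (U : Matrix.unitaryGroup (Bits (Fin n)) ℂ)
    (M : Predicate V) : Predicate V :=
  ⟨(embed q (U : Op (Fin n))).conjTranspose * M.1 * embed q (U : Op (Fin n)), by
    have h := isPredicate_sum (fun _ : Unit => embed q (U : Op (Fin n)))
      (by
        have hU : (U : Op (Fin n)).conjTranspose * (U : Op (Fin n)) = 1 :=
          Matrix.mem_unitaryGroup_iff'.1 U.2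
        simp [embed_conjTranspose, ← embed_mul, hU, embed_one]) (fun _ => M)
    simpa using h⟩

/-- `P⁰ M₀ P⁰ + P¹ M₁ P¹` on `q`. -/
noncomputable def Predicate.preMeas {n : ℕ} (M : Measurement n) (q : Fin n ↪ V) (M₀ M₁ : Predicate V) :
    Predicate V :=
  ⟨measOp M q 0 M₀.1 + measOp M q 1 M₁.1, by
    have hadj : ∀ b, (embed q (M.P b)).conjTranspose = embed q (M.P b) := fun b => by
      rw [embed_conjTranspose, (M.isHermitian b).eq]
    have h := isPredicate_sum (fun b : Fin 2 => embed q (M.P b))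
      (by
        simp only [hadj, ← embed_mul, M.idempotent, ← embed_sum]
        rw [Fin.sum_univ_two, M.complete, embed_one]) ![M₀, M₁]
    simpa [measOp, conjBy, hadj, Fin.sum_univ_two] using h⟩

/-- The assertion with a single predicate. -/
def Assertion.single (M : Predicate V) : Assertion V := ⟨{M}, Set.singleton_nonempty M⟩

/-- Element-wise application of an operation on predicates. -/
def Assertion.map (f : Predicate V → Predicate V) (Θ : Assertion V) : Assertion V :=
  ⟨f '' Θ.1, Θ.2.image f⟩

/-- The element-wise `𝒫⁰(Θ₀) + 𝒫¹(Θ₁)` on `q`. -/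
def Assertion.preMeas {n : ℕ} (M : Measurement n) (q : Fin n ↪ V) (Θ₀ Θ₁ : Assertion V) :
    Assertion V :=
  ⟨Set.image2 (Predicate.preMeas M q) Θ₀.1 Θ₁.1, Θ₀.2.image2 Θ₁.2⟩

/-- The union of a nonempty family of assertions. -/
def Assertion.iUnion {I : Type u} [Nonempty I] (Θ : I → Assertion V) : Assertion V :=
  ⟨⋃ i, (Θ i).1, Set.nonempty_iUnion.2 ⟨Classical.arbitrary I, (Θ _).2⟩⟩

/-! ### The proof system -/

/-- Derivability of the correctness formula `{Θ} S {Ψ}` in the proof system for partial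
correctness. -/
inductive Derivable : Assertion V → Prog V → Assertion V → Prop
  | skip (Θ : Assertion V) : Derivable Θ .skip Θ
  | abort : Derivable (Assertion.single Predicate.top) .abort (Assertion.single Predicate.bot)
  | init {n : ℕ} (q : Fin n ↪ V) (Θ : Assertion V) :
      Derivable (Θ.map (Predicate.preSetZero q)) (.setZero q) Θ
  | unit {n : ℕ} (q : Fin n ↪ V) (U : Matrix.unitaryGroup (Bits (Fin n)) ℂ)
      (Θ : Assertion V) :
      Derivable (Θ.map (Predicate.preUnitary q U)) (.unitary q U) Θ
  | seq {S₀ S₁ : Prog V} {Θ Θ' Ψ : Assertion V} :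
      Derivable Θ S₀ Θ' → Derivable Θ' S₁ Ψ → Derivable Θ (.seq S₀ S₁) Ψ
  | ndet {S₀ S₁ : Prog V} {Θ Ψ : Assertion V} :
      Derivable Θ S₀ Ψ → Derivable Θ S₁ Ψ → Derivable Θ (.choice S₀ S₁) Ψ
  | meas {n : ℕ} (M : Measurement n) (q : Fin n ↪ V) {S₀ S₁ : Prog V}
      {Θ₀ Θ₁ Ψ : Assertion V} :
      Derivable Θ₁ S₁ Ψ → Derivable Θ₀ S₀ Ψ →
        Derivable (Assertion.preMeas M q Θ₀ Θ₁) (.cond M q S₁ S₀) Ψ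
  | while {n : ℕ} (M : Measurement n) (q : Fin n ↪ V) {S : Prog V} {Θ Ψ : Assertion V} :
      Derivable Θ S (Assertion.preMeas M q Ψ Θ) →
        Derivable (Assertion.preMeas M q Ψ Θ) (.loop M q S) Ψ
  | imp {S : Prog V} {Θ Θ' Ψ Ψ' : Assertion V} :
      leInf Θ Θ' → Derivable Θ' S Ψ' → leInf Ψ' Ψ → Derivable Θ S Ψ
  | union {I : Type u} [Nonempty I] {S : Prog V} (Θ Ψ : I → Assertion V) :
      (∀ i, Derivable (Θ i) S (Ψ i)) →
        Derivable (Assertion.iUnion Θ) S (Assertion.iUnion Ψ)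

end NQP

/-! Pairing by the trace turns super-operators on states into maps on predicates. For `E ∈ ⟦S⟧` and
a predicate `M`, the right side of partial correctness at `ρ` is `tr (Nρ)` with `N = E†(M) + I -
E†(I)`, again a predicate because `E` is positive and does not increase the trace. Collecting these
`N` gives `wlp S Ψ`, and truth of `{Θ} S {Ψ}` yields `Θ ≤_inf wlp S Ψ`
(`PartiallyCorrect.leInf_wlp`). By (Imp), completeness reduces to deriving `{wlp S Ψ} S {Ψ}`, by
induction on `S` (`derivable_wlp`). An assertion with more elements is lower in `≤_inf`, so one
inclusion of sets suffices in each case. For conditionals and loops, (Union) first reduces to a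
single postcondition; the loop invariant comes from unrolling one iteration
(`preMeas_subset_wlp_loop`). Soundness is an induction on derivations. For a loop, the invariant
bounds every finite number of rounds (`PartiallyCorrect.loop`), and mass that never exits is
credited in full. Loop semantics rests on conservation of trace at each measurement: exit masses sum
to at most `tr ρ`, so the series converges (`sum_trace_rounds_le`, `summable_rounds`). -/

namespace Matrix

/-! ### Positive semidefinite matrices and the trace pairing -/

variable {n : Type*} [Fintype n]

theorem PosSemidef.trace_mul_nonneg {A B : Matrix n n ℂ} (hA : A.PosSemidef)
    (hB : B.PosSemidef) : 0 ≤ (A * B).trace := by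
  obtain ⟨m, v, rfl⟩ := posSemidef_iff_eq_sum_vecMulVec.1 hB
  rw [Finset.mul_sum, trace_sum]
  refine Finset.sum_nonneg fun i _ => ?_
  rw [mul_vecMulVec, trace_vecMulVec, dotProduct_comm]
  exact hA.dotProduct_mulVec_nonneg _

/-- Over `ℂ` a real-valued quadratic form already forces the matrix to be Hermitian. -/
theorem posSemidef_of_dotProduct_mulVec_nonneg {A : Matrix n n ℂ}
    (h : ∀ x, 0 ≤ star x ⬝ᵥ (A *ᵥ x)) : A.PosSemidef := by
  classical
  rw [← isPositive_toEuclideanLin_iff, LinearMap.isPositive_iff_complex]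
  intro x
  have hx : 0 ≤ inner ℂ (A.toEuclideanLin x) x := by
    have := star_le_star_iff.2 (h x.ofLp)
    rw [star_zero, Matrix.star_dotProduct] at this
    simpa [EuclideanSpace.inner_eq_star_dotProduct, dotProduct_comm] using this
  obtain ⟨h1, h2⟩ := Complex.le_def.1 hx
  exact ⟨Complex.ext (by simp) (by simpa using h2), by simpa using h1⟩

/-- Testing on rank-one matrices recovers the quadratic form; with `PosSemidef.trace_mul_nonneg`,
the cone is self-dual. -/
theorem posSemidef_of_trace_mul_nonneg {A : Matrix n n ℂ}
    (h : ∀ B : Matrix n n ℂ, B.PosSemidef → 0 ≤ (A * B).trace) : A.PosSemidef := by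
  refine posSemidef_of_dotProduct_mulVec_nonneg fun x => ?_
  have := h _ (posSemidef_vecMulVec_self_star x)
  rwa [mul_vecMulVec, trace_vecMulVec, dotProduct_comm] at this

theorem PosSemidef.norm_apply_le_trace {A : Matrix n n ℂ} (hA : A.PosSemidef) (i j : n) :
    ‖A i j‖ ≤ A.trace.re := by
  obtain ⟨m, v, rfl⟩ := posSemidef_iff_eq_sum_vecMulVec.1 hA
  rw [sum_apply, trace_sum, Complex.re_sum]
  refine (norm_sum_le _ _).trans (Finset.sum_le_sum fun k _ => ?_)
  have hre : (vecMulVec (v k) (star (v k))).trace.re = ∑ l, ‖v k l‖ ^ 2 := by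
    simp [trace, vecMulVec_apply, Complex.mul_conj, Complex.normSq_eq_norm_sq]
    norm_cast
  rw [hre, vecMulVec_apply, norm_mul, Pi.star_apply, norm_star]
  have hi := Finset.single_le_sum (f := fun l => ‖v k l‖ ^ 2) (fun l _ => sq_nonneg _)
    (Finset.mem_univ i)
  have hj := Finset.single_le_sum (f := fun l => ‖v k l‖ ^ 2) (fun l _ => sq_nonneg _)
    (Finset.mem_univ j)
  -- AM-GM: twice the product is at most the sum of two squares, each bounded by the rank-one trace.
  nlinarith [sq_nonneg (‖v k i‖ - ‖v k j‖)]

theorem vecMulVec_star_mem_span_posSemidef (x y : n → ℂ) :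
    vecMulVec x (star y) ∈ Submodule.span ℂ {A : Matrix n n ℂ | A.PosSemidef} := by
  have hw (c : ℂ) : vecMulVec (x + c • y) (star (x + c • y)) ∈
      Submodule.span ℂ {A : Matrix n n ℂ | A.PosSemidef} :=
    Submodule.subset_span (posSemidef_vecMulVec_self_star _)
  -- Polarization: average `c (x + cy)(x + cy)†` over the fourth roots of unity `c`.
  have key : vecMulVec x (star y) = (1 / 4 : ℂ) •
      (vecMulVec (x + (1 : ℂ) • y) (star (x + (1 : ℂ) • y))
      - vecMulVec (x + (-1 : ℂ) • y) (star (x + (-1 : ℂ) • y))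
      + Complex.I • vecMulVec (x + Complex.I • y) (star (x + Complex.I • y))
      - Complex.I • vecMulVec (x + (-Complex.I) • y) (star (x + (-Complex.I) • y))) := by
    ext a b
    simp only [vecMulVec_apply, Pi.star_apply, Pi.add_apply, Pi.smul_apply, smul_apply,
      add_apply, sub_apply, smul_eq_mul, star_add, star_mul', star_neg, star_one,
      Complex.star_def, Complex.conj_I]
    linear_combination (1 / 2 * x a * (starRingEnd ℂ) (y b)
      - 1 / 2 * y a * (starRingEnd ℂ) (x b)) * Complex.I_sq
  rw [key]
  exact Submodule.smul_mem _ _ (Submodule.sub_mem _ (Submodule.add_mem _ (Submodule.sub_mem _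
    (hw _) (hw _)) (Submodule.smul_mem _ _ (hw _))) (Submodule.smul_mem _ _ (hw _)))

theorem span_posSemidef : Submodule.span ℂ {A : Matrix n n ℂ | A.PosSemidef} = ⊤ := by
  classical
  rw [eq_top_iff]
  rintro A -
  rw [matrix_eq_sum_single A]
  refine Submodule.sum_mem _ fun i _ => Submodule.sum_mem _ fun j _ => ?_
  have hs : single i j (A i j) = A i j • vecMulVec (Pi.single i 1) (star (Pi.single j 1)) := by
    ext a b
    simp only [single_apply, smul_apply, vecMulVec_apply, Pi.star_apply, Pi.single_apply]
    by_cases h1 : i = a <;> by_cases h2 : j = b <;> simp [eq_comm, h1, h2]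
  rw [hs]
  exact Submodule.smul_mem _ _ (vecMulVec_star_mem_span_posSemidef _ _)

theorem summable_of_posSemidef {f : ℕ → Matrix n n ℂ} (hf : ∀ k, (f k).PosSemidef) {c : ℝ}
    (h : ∀ k, ∑ i ∈ Finset.range k, (f i).trace.re ≤ c) : Summable f := by
  have ht : Summable fun k => (f k).trace.re :=
    summable_of_sum_range_le (fun k => (Complex.le_def.1 (hf k).trace_nonneg).1) h
  refine Pi.summable.2 fun i => Pi.summable.2 fun j => ?_
  exact Summable.of_norm_bounded ht fun k => (hf k).norm_apply_le_trace i j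

/-- The adjoint of a linear map on matrices for the bilinear form `tr (A B)`. -/
theorem exists_trace_adjoint [DecidableEq n] (E : Matrix n n ℂ →ₗ[ℂ] Matrix n n ℂ)
    (A : Matrix n n ℂ) : ∃ B : Matrix n n ℂ, ∀ X, (B * X).trace = (A * E X).trace := by
  -- These entries are forced by taking `X` to be a matrix unit.
  refine ⟨of fun i j => (A * E (single j i 1)).trace, fun X => ?_⟩
  conv_rhs => rw [matrix_eq_sum_single X]
  simp only [map_sum, Finset.mul_sum, trace_sum]
  rw [Finset.sum_comm]
  simp only [trace, diag_apply, mul_apply, of_apply]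
  refine Finset.sum_congr rfl fun i _ => Finset.sum_congr rfl fun j _ => ?_
  have hs : single j i (X j i) = X j i • single j i (1 : ℂ) := by simp [smul_single]
  rw [hs, map_smul]
  simp only [smul_apply, smul_eq_mul, Finset.sum_mul]
  exact Finset.sum_congr rfl fun k _ => Finset.sum_congr rfl fun l _ => by ring

end Matrix

namespace NQP

open Matrix

variable {V : Type u} [Fintype V] [DecidableEq V]

/-! ### Quantum operations -/

/-- Positive, trace-nonincreasing linear maps on operators. -/
def IsOperation (E : SuperOp V) : Prop :=
  ∀ ρ : Op V, ρ.PosSemidef → (E ρ).PosSemidef ∧ (E ρ).trace.re ≤ ρ.trace.re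

theorem IsOperation.isState {E : SuperOp V} (hE : IsOperation E) {ρ : Op V} (hρ : IsState ρ) :
    IsState (E ρ) :=
  ⟨(hE ρ hρ.1).1, (hE ρ hρ.1).2.trans hρ.2⟩

theorem IsOperation.id : IsOperation (LinearMap.id : SuperOp V) := fun _ hρ => ⟨hρ, le_rfl⟩

theorem re_trace_nonneg {A : Op V} (hA : A.PosSemidef) : 0 ≤ A.trace.re :=
  (Complex.le_def.1 hA.trace_nonneg).1

theorem IsOperation.zero : IsOperation (0 : SuperOp V) := fun ρ hρ =>
  ⟨by simpa using PosSemidef.zero, by simpa using re_trace_nonneg hρ⟩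

theorem IsOperation.comp {E F : SuperOp V} (hF : IsOperation F) (hE : IsOperation E) :
    IsOperation (F ∘ₗ E) := fun ρ hρ =>
  ⟨(hF _ (hE ρ hρ).1).1, (hF _ (hE ρ hρ).1).2.trans (hE ρ hρ).2⟩

/-- Cyclicity of the trace moves `K` from the state to the predicate. -/
theorem trace_mul_conjBy (A K ρ : Op V) :
    (A * conjBy K ρ).trace = (Kᴴ * A * K * ρ).trace := by
  change (A * (K * ρ * Kᴴ)).trace = _
  rw [← mul_assoc, trace_mul_comm]
  simp only [mul_assoc]

theorem trace_conjBy (K ρ : Op V) : (conjBy K ρ).trace = (Kᴴ * K * ρ).trace := by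
  simpa using trace_mul_conjBy 1 K ρ

theorem posSemidef_conjBy (K : Op V) {ρ : Op V} (hρ : ρ.PosSemidef) :
    (conjBy K ρ).PosSemidef := hρ.mul_mul_conjTranspose_same K

theorem posSemidef_measOp {n : ℕ} (M : Measurement n) (q : Fin n ↪ V) (b : Fin 2) {ρ : Op V}
    (hρ : ρ.PosSemidef) : (measOp M q b ρ).PosSemidef := posSemidef_conjBy _ hρ

theorem embed_ketbra_conjTranspose {n : ℕ} (q : Fin n ↪ V) (x y : Bits (Fin n)) :
    (embed q (ketbra x y))ᴴ = embed q (ketbra y x) := by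
  simp [embed_conjTranspose, ketbra, conjTranspose_single]

theorem embed_P_conjTranspose {n : ℕ} (M : Measurement n) (q : Fin n ↪ V) (b : Fin 2) :
    (embed q (M.P b))ᴴ = embed q (M.P b) := by
  rw [embed_conjTranspose, (M.isHermitian b).eq]

theorem trace_measOp_add {n : ℕ} (M : Measurement n) (q : Fin n ↪ V) (ρ : Op V) :
    (measOp M q 0 ρ).trace + (measOp M q 1 ρ).trace = ρ.trace := by
  have h : embed q (M.P 0) + embed q (M.P 1) = 1 := by
    have hs := embed_sum q Finset.univ M.P
    rwa [Fin.sum_univ_two, Fin.sum_univ_two, M.complete, embed_one, eq_comm] at hs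
  simp only [measOp, trace_conjBy, embed_P_conjTranspose, ← embed_mul, M.idempotent]
  rw [← trace_add, ← add_mul, h, one_mul]

theorem trace_mul_preMeas {n : ℕ} (M : Measurement n) (q : Fin n ↪ V) (A B : Predicate V)
    (ρ : Op V) : ((Predicate.preMeas M q A B).1 * ρ).trace =
      (A.1 * measOp M q 0 ρ).trace + (B.1 * measOp M q 1 ρ).trace := by
  simp only [measOp, trace_mul_conjBy, embed_P_conjTranspose, ← trace_add, ← add_mul]
  congr 2
  simp [Predicate.preMeas, measOp, conjBy, embed_P_conjTranspose]

theorem isOperation_measOp {n : ℕ} (M : Measurement n) (q : Fin n ↪ V) (b : Fin 2) :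
    IsOperation (measOp M q b) := fun ρ hρ => by
  have h := congrArg Complex.re (trace_measOp_add M q ρ)
  have h0 := re_trace_nonneg (posSemidef_measOp M q 0 hρ)
  have h1 := re_trace_nonneg (posSemidef_measOp M q 1 hρ)
  rw [Complex.add_re] at h
  refine ⟨posSemidef_measOp M q b hρ, ?_⟩
  fin_cases b <;> simp only [Fin.zero_eta, Fin.mk_one] <;> linarith

theorem trace_mul_setZeroOp {n : ℕ} (q : Fin n ↪ V) (A : Predicate V) (ρ : Op V) :
    ((Predicate.preSetZero q A).1 * ρ).trace = (A.1 * setZeroOp q ρ).trace := by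
  simp only [setZeroOp, LinearMap.sum_apply, Finset.mul_sum, trace_sum, trace_mul_conjBy,
    embed_ketbra_conjTranspose, Predicate.preSetZero, Finset.sum_mul]

theorem trace_setZeroOp {n : ℕ} (q : Fin n ↪ V) (ρ : Op V) :
    (setZeroOp q ρ).trace = ρ.trace := by
  simp only [setZeroOp, LinearMap.sum_apply, trace_sum, trace_conjBy,
    embed_ketbra_conjTranspose, ← embed_mul]
  rw [← trace_sum, ← Finset.sum_mul, ← embed_sum]
  simp [ketbra, sum_single_one, embed_one]

theorem isOperation_setZeroOp {n : ℕ} (q : Fin n ↪ V) : IsOperation (setZeroOp q) :=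
  fun ρ hρ => by
    refine ⟨?_, (congrArg Complex.re (trace_setZeroOp q ρ)).le⟩
    rw [setZeroOp, LinearMap.sum_apply]
    exact posSemidef_sum _ fun i _ => posSemidef_conjBy _ hρ

theorem trace_mul_conjBy_unitary {n : ℕ} (q : Fin n ↪ V)
    (U : unitaryGroup (Bits (Fin n)) ℂ) (A : Predicate V) (ρ : Op V) :
    ((Predicate.preUnitary q U A).1 * ρ).trace
      = (A.1 * conjBy (embed q (U : Op (Fin n))) ρ).trace :=
  (trace_mul_conjBy _ _ _).symm

theorem trace_conjBy_unitary {n : ℕ} (q : Fin n ↪ V) (U : unitaryGroup (Bits (Fin n)) ℂ)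
    (ρ : Op V) : (conjBy (embed q (U : Op (Fin n))) ρ).trace = ρ.trace := by
  have hU : (U : Op (Fin n))ᴴ * (U : Op (Fin n)) = 1 := mem_unitaryGroup_iff'.1 U.2
  rw [trace_conjBy, embed_conjTranspose, ← embed_mul, hU, embed_one, one_mul]

theorem isOperation_conjBy_unitary {n : ℕ} (q : Fin n ↪ V)
    (U : unitaryGroup (Bits (Fin n)) ℂ) : IsOperation (conjBy (embed q (U : Op (Fin n)))) :=
  fun ρ hρ => ⟨posSemidef_conjBy _ hρ, (congrArg Complex.re (trace_conjBy_unitary q U ρ)).le⟩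

theorem IsOperation.cond {n : ℕ} (M : Measurement n) (q : Fin n ↪ V) {E F : SuperOp V}
    (hE : IsOperation E) (hF : IsOperation F) :
    IsOperation (E ∘ₗ measOp M q 0 + F ∘ₗ measOp M q 1) := fun ρ hρ => by
  have h0 := hE _ (posSemidef_measOp M q 0 hρ)
  have h1 := hF _ (posSemidef_measOp M q 1 hρ)
  refine ⟨h0.1.add h1.1, ?_⟩
  have h := congrArg Complex.re (trace_measOp_add M q ρ)
  rw [Complex.add_re] at h
  simp only [LinearMap.add_apply, LinearMap.comp_apply, trace_add, Complex.add_re]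
  linarith [h0.2, h1.2]

/-! ### Loops -/

section Loop

variable {n : ℕ} (M : Measurement n) (q : Fin n ↪ V) {η : ℕ → SuperOp V}

theorem isOperation_rounds (hη : ∀ k, IsOperation (η k)) (k : ℕ) :
    IsOperation (rounds M q η k) := by
  induction k with
  | zero => exact .id
  | succ k ih => exact (hη k).comp ((isOperation_measOp M q 1).comp ih)

/-- The definition peels off the last round; unrolling a loop needs the first. -/
theorem rounds_succ' (η : ℕ → SuperOp V) (k : ℕ) :
    rounds M q η (k + 1) = rounds M q (fun i => η (i + 1)) k ∘ₗ η 0 ∘ₗ measOp M q 1 := by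
  induction k with
  | zero => rfl
  | succ k ih =>
    rw [rounds, ih]
    rfl

/-- Each measurement splits the remaining mass into an exiting and a continuing part, and the body
can only lose mass. -/
theorem sum_trace_rounds_le (hη : ∀ k, IsOperation (η k)) {ρ : Op V} (hρ : ρ.PosSemidef)
    (k : ℕ) :
    ∑ i ∈ Finset.range k, (measOp M q 0 (rounds M q η i ρ)).trace.re
      + (rounds M q η k ρ).trace.re ≤ ρ.trace.re := by
  induction k with
  | zero => simp [rounds]
  | succ k ih =>
    have h := congrArg Complex.re (trace_measOp_add M q (rounds M q η k ρ))
    have h1 := (hη k _ (posSemidef_measOp M q 1 (isOperation_rounds M q hη k ρ hρ).1)).2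
    rw [Complex.add_re] at h
    rw [Finset.sum_range_succ]
    simp only [rounds, LinearMap.comp_apply]
    linarith

/-- For positive `ρ` the exit traces have bounded partial sums and dominate all entries; linearity
extends this to every operator. -/
theorem summable_rounds (hη : ∀ k, IsOperation (η k)) (ρ : Op V) :
    Summable fun k => measOp M q 0 (rounds M q η k ρ) := by
  have hρ : ρ ∈ Submodule.span ℂ {A : Op V | A.PosSemidef} := by
    rw [span_posSemidef]; trivial
  induction hρ using Submodule.span_induction with
  | mem ρ hρ =>
    have hk (k : ℕ) := (isOperation_rounds M q hη k ρ hρ).1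
    refine summable_of_posSemidef (fun k => posSemidef_measOp M q 0 (hk k))
      (c := ρ.trace.re) fun k => ?_
    linarith [sum_trace_rounds_le M q hη hρ k, re_trace_nonneg (hk k)]
  | zero => simp
  | add x y _ _ hx hy => simpa using hx.add hy
  | smul c x _ hx => simpa using hx.const_smul c

theorem exists_hasSum_rounds (hη : ∀ k, IsOperation (η k)) :
    ∃ G : SuperOp V, ∀ ρ, HasSum (fun k => measOp M q 0 (rounds M q η k ρ)) (G ρ) := by
  have hs (ρ : Op V) := (summable_rounds M q hη ρ).hasSum
  refine ⟨{ toFun := fun ρ => ∑' k, measOp M q 0 (rounds M q η k ρ), map_add' := ?_,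
            map_smul' := ?_ }, hs⟩
  · intro x y
    have := (hs x).add (hs y)
    simp only [← map_add] at this
    exact this.tsum_eq
  · intro c x
    have := (hs x).const_smul c
    simp only [← map_smul] at this
    exact this.tsum_eq

theorem tendsto_re_trace_mul {f : ℕ → Op V} {B : Op V} (h : HasSum f B) (A : Op V) :
    Filter.Tendsto (fun k => ∑ i ∈ Finset.range k, (A * f i).trace.re) Filter.atTop
      (nhds (A * B).trace.re) := by
  have hc : Continuous fun X : Op V => (A * X).trace.re := by fun_prop
  have := (hc.tendsto B).comp h.tendsto_sum_nat
  simpa [Function.comp_def, Finset.mul_sum, trace_sum] using this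

theorem isOperation_of_hasSum_rounds (hη : ∀ k, IsOperation (η k)) {G : SuperOp V}
    (hG : ∀ ρ, HasSum (fun k => measOp M q 0 (rounds M q η k ρ)) (G ρ)) : IsOperation G := by
  intro ρ hρ
  have hk (k : ℕ) := (isOperation_rounds M q hη k ρ hρ).1
  constructor
  · refine posSemidef_of_trace_mul_nonneg fun B hB => ?_
    have hc : Continuous fun X : Op V => (X * B).trace := by fun_prop
    have := (hc.tendsto _).comp (hG ρ).tendsto_sum_nat
    refine ge_of_tendsto' this fun k => ?_
    exact (posSemidef_sum _ fun i _ => posSemidef_measOp M q 0 (hk i)).trace_mul_nonneg hB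
  · have h := tendsto_re_trace_mul (hG ρ) 1
    simp only [one_mul] at h
    exact le_of_tendsto' h fun k => by
      linarith [sum_trace_rounds_le M q hη hρ k, re_trace_nonneg (hk k)]

end Loop

theorem isOperation_of_mem_sem {S : Prog V} : ∀ {E : SuperOp V}, E ∈ sem S → IsOperation E := by
  induction S with
  | skip => rintro _ rfl; exact .id
  | abort => rintro _ rfl; exact .zero
  | setZero q => rintro _ rfl; exact isOperation_setZeroOp q
  | unitary q U => rintro _ rfl; exact isOperation_conjBy_unitary q U
  | seq S₀ S₁ h₀ h₁ => rintro _ ⟨E, hE, F, hF, rfl⟩; exact (h₁ hF).comp (h₀ hE)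
  | choice S₀ S₁ h₀ h₁ => rintro _ (h | h); exacts [h₀ h, h₁ h]
  | cond M q S₁ S₀ h₁ h₀ =>
    rintro _ ⟨E, hE, F, hF, rfl⟩; exact .cond M q (h₀ hE) (h₁ hF)
  | loop M q S h =>
    rintro G ⟨η, hη, hG⟩; exact isOperation_of_hasSum_rounds M q (fun k => h (hη k)) hG

/-- Keeps the infimum over `⟦S⟧` from being the default value of `sInf ∅`. A loop gets a constant
scheduler. -/
theorem sem_nonempty (S : Prog V) : (sem S).Nonempty := by
  induction S with
  | skip | abort | setZero | unitary => exact Set.singleton_nonempty _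
  | seq S₀ S₁ h₀ h₁ =>
    obtain ⟨E, hE⟩ := h₀
    obtain ⟨F, hF⟩ := h₁
    exact ⟨_, E, hE, F, hF, rfl⟩
  | choice S₀ S₁ h₀ h₁ => exact h₀.inl
  | cond M q S₁ S₀ h₁ h₀ =>
    obtain ⟨E, hE⟩ := h₀
    obtain ⟨F, hF⟩ := h₁
    exact ⟨_, E, hE, F, hF, rfl⟩
  | loop M q S h =>
    obtain ⟨E, hE⟩ := h
    obtain ⟨G, hG⟩ := exists_hasSum_rounds M q (η := fun _ => E)
      fun _ => isOperation_of_mem_sem hE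
    exact ⟨G, fun _ => E, fun _ => hE, hG⟩

end NQP

namespace NQP

open Matrix

variable {V : Type u} [Fintype V] [DecidableEq V]

/-! ### Expectations -/

theorem bddBelow_expect {ρ : Op V} (hρ : ρ.PosSemidef) (Θ : Assertion V) :
    BddBelow (Set.range fun M : Θ.1 => ((M.1.1 : Op V) * ρ).trace.re) := by
  refine ⟨0, ?_⟩
  rintro _ ⟨M, rfl⟩
  exact (Complex.le_def.1 (M.1.2.1.trace_mul_nonneg hρ)).1

theorem expect_le {ρ : Op V} (hρ : ρ.PosSemidef) {Θ : Assertion V} {M : Predicate V}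
    (hM : M ∈ Θ.1) : expect ρ Θ ≤ (M.1 * ρ).trace.re :=
  ciInf_le (bddBelow_expect hρ Θ) ⟨M, hM⟩

theorem le_expect {ρ : Op V} {Θ : Assertion V} {c : ℝ}
    (h : ∀ M ∈ Θ.1, c ≤ (M.1 * ρ).trace.re) : c ≤ expect ρ Θ :=
  have := Θ.2.to_subtype
  le_ciInf fun M => h M.1 M.2

theorem expect_nonneg {ρ : Op V} (hρ : ρ.PosSemidef) (Θ : Assertion V) : 0 ≤ expect ρ Θ :=
  le_expect fun M _ => (Complex.le_def.1 (M.2.1.trace_mul_nonneg hρ)).1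

theorem leInf.refl (Θ : Assertion V) : leInf Θ Θ := fun _ _ => le_rfl

theorem leInf_of_subset {Θ Ψ : Assertion V} (h : Ψ.1 ⊆ Θ.1) : leInf Θ Ψ := fun _ hρ =>
  le_expect fun _ hM => expect_le hρ.1 (h hM)

/-- The two predicates are chosen independently, so the infimum of the sum splits. -/
theorem expect_preMeas {n : ℕ} (M : Measurement n) (q : Fin n ↪ V) (Θ₀ Θ₁ : Assertion V)
    {ρ : Op V} (hρ : ρ.PosSemidef) : expect ρ (Assertion.preMeas M q Θ₀ Θ₁) =
      expect (measOp M q 0 ρ) Θ₀ + expect (measOp M q 1 ρ) Θ₁ := by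
  apply le_antisymm
  · rw [← sub_le_iff_le_add]
    refine le_expect fun A hA => ?_
    rw [sub_le_comm]
    refine le_expect fun B hB => ?_
    have := expect_le hρ (Θ := Assertion.preMeas M q Θ₀ Θ₁) (Set.mem_image2_of_mem hA hB)
    rw [trace_mul_preMeas, Complex.add_re] at this
    linarith
  · refine le_expect ?_
    rintro _ ⟨A, hA, B, hB, rfl⟩
    rw [trace_mul_preMeas, Complex.add_re]
    exact add_le_add (expect_le (posSemidef_measOp M q 0 hρ) hA)
      (expect_le (posSemidef_measOp M q 1 hρ) hB)

theorem partiallyCorrect_iff {Θ Ψ : Assertion V} {S : Prog V} :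
    PartiallyCorrect Θ S Ψ ↔ ∀ ρ : Op V, IsState ρ → ∀ E ∈ sem S, ∀ M ∈ Ψ.1,
      expect ρ Θ ≤ (M.1 * E ρ).trace.re + ρ.trace.re - (E ρ).trace.re := by
  refine forall₂_congr fun ρ hρ => ⟨fun h E hE M hM => ?_, fun h => ?_⟩
  · refine h.trans (le_trans (csInf_le ⟨0, ?_⟩ ⟨E ρ, ⟨E, hE, rfl⟩, rfl⟩) ?_)
    · rintro _ ⟨_, ⟨F, hF, rfl⟩, rfl⟩
      have hF := isOperation_of_mem_sem hF ρ hρ.1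
      linarith [hF.2, expect_nonneg hF.1 Ψ]
    · linarith [expect_le (isOperation_of_mem_sem hE ρ hρ.1).1 hM]
  · obtain ⟨E, hE⟩ := sem_nonempty S
    refine le_csInf ⟨_, ⟨E ρ, ⟨E, hE, rfl⟩, rfl⟩⟩ ?_
    rintro _ ⟨_, ⟨F, hF, rfl⟩, rfl⟩
    have : expect ρ Θ - ρ.trace.re + (F ρ).trace.re ≤ expect (F ρ) Ψ :=
      le_expect fun M hM => by linarith [h F hF M hM]
    linarith

theorem PartiallyCorrect.expect_le {Θ Ψ : Assertion V} {S : Prog V}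
    (h : PartiallyCorrect Θ S Ψ) {ρ : Op V} (hρ : IsState ρ) {E : SuperOp V} (hE : E ∈ sem S) :
    expect ρ Θ ≤ expect (E ρ) Ψ + ρ.trace.re - (E ρ).trace.re := by
  have : expect ρ Θ - ρ.trace.re + (E ρ).trace.re ≤ expect (E ρ) Ψ :=
    le_expect fun M hM => by linarith [partiallyCorrect_iff.1 h ρ hρ E hE M hM]
  linarith

/-! ### Soundness -/

theorem PartiallyCorrect.loop {n : ℕ} {M : Measurement n} {q : Fin n ↪ V} {S : Prog V}
    {Θ Ψ : Assertion V} (h : PartiallyCorrect Θ S (Assertion.preMeas M q Ψ Θ)) :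
    PartiallyCorrect (Assertion.preMeas M q Ψ Θ) (.loop M q S) Ψ := by
  refine partiallyCorrect_iff.2 ?_
  rintro ρ hρ G ⟨η, hη, hG⟩ A hA
  have hop (k : ℕ) := isOperation_of_mem_sem (hη k)
  have hst (k : ℕ) : IsState (rounds M q η k ρ) := (isOperation_rounds M q hop k).isState hρ
  -- After `k` rounds: the value of the exited part, the invariant's value on the part still
  -- running, and the mass lost so far.
  have key (k : ℕ) : expect ρ (Assertion.preMeas M q Ψ Θ) ≤
      ∑ i ∈ Finset.range k, (A.1 * measOp M q 0 (rounds M q η i ρ)).trace.re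
        - ∑ i ∈ Finset.range k, (measOp M q 0 (rounds M q η i ρ)).trace.re
        + expect (rounds M q η k ρ) (Assertion.preMeas M q Ψ Θ)
        + ρ.trace.re - (rounds M q η k ρ).trace.re := by
    induction k with
    | zero => simp [rounds]
    | succ k ih =>
      have hσ := hst k
      set σ := rounds M q η k ρ with hσdef
      have htr := congrArg Complex.re (trace_measOp_add M q σ)
      rw [Complex.add_re] at htr
      have h0 := NQP.expect_le (posSemidef_measOp M q 0 hσ.1) hA
      have h1 := h.expect_le ((isOperation_measOp M q 1).isState hσ) (hη k)
      have hs : rounds M q η (k + 1) ρ = η k (measOp M q 1 σ) := rfl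
      rw [Finset.sum_range_succ, Finset.sum_range_succ, hs, ← hσdef]
      rw [expect_preMeas M q Ψ Θ hσ.1] at ih
      linarith
  have hlim := ((tendsto_re_trace_mul (hG ρ) A.1).sub
    (tendsto_re_trace_mul (hG ρ) 1)).add_const ρ.trace.re
  simp only [one_mul] at hlim
  refine (ge_of_tendsto' hlim fun k => ?_).trans_eq (by ring)
  -- Since `B ⊑ I`, the invariant's value on the running part is at most its trace, so both terms
  -- drop out even if that trace does not tend to zero.
  obtain ⟨B, hB⟩ := (Assertion.preMeas M q Ψ Θ).2
  have h1 := NQP.expect_le (hst k).1 hB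
  have h2 := (Complex.le_def.1 (B.2.2.trace_mul_nonneg (hst k).1)).1
  rw [sub_mul, one_mul, trace_sub, Complex.sub_re, Complex.zero_re] at h2
  linarith [key k]

theorem Derivable.partiallyCorrect {Θ Ψ : Assertion V} {S : Prog V} (h : Derivable Θ S Ψ) :
    PartiallyCorrect Θ S Ψ := by
  induction h with
  | skip Θ =>
    refine partiallyCorrect_iff.2 ?_
    rintro ρ hρ _ rfl M hM
    simpa using expect_le hρ.1 hM
  | abort =>
    refine partiallyCorrect_iff.2 ?_
    rintro ρ hρ _ rfl M hM
    simpa [Predicate.top] using expect_le hρ.1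
      (Θ := .single Predicate.top) (Set.mem_singleton _)
  | init q Θ =>
    refine partiallyCorrect_iff.2 ?_
    rintro ρ hρ _ rfl M hM
    have := expect_le hρ.1 (Θ := Θ.map (Predicate.preSetZero q)) (Set.mem_image_of_mem _ hM)
    rw [trace_mul_setZeroOp] at this
    rw [trace_setZeroOp]
    linarith
  | unit q U Θ =>
    refine partiallyCorrect_iff.2 ?_
    rintro ρ hρ _ rfl M hM
    have := expect_le hρ.1 (Θ := Θ.map (Predicate.preUnitary q U)) (Set.mem_image_of_mem _ hM)
    rw [trace_mul_conjBy_unitary] at this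
    rw [trace_conjBy_unitary]
    linarith
  | seq _ _ h₀ h₁ =>
    refine partiallyCorrect_iff.2 ?_
    rintro ρ hρ _ ⟨E, hE, F, hF, rfl⟩ M hM
    have h1 := h₀.expect_le hρ hE
    have h2 := partiallyCorrect_iff.1 h₁ _ ((isOperation_of_mem_sem hE).isState hρ) F hF M hM
    rw [LinearMap.comp_apply]
    linarith
  | ndet _ _ h₀ h₁ =>
    rw [partiallyCorrect_iff] at *
    rintro ρ hρ E (hE | hE)
    exacts [h₀ ρ hρ E hE, h₁ ρ hρ E hE]
  | meas M q _ _ h₁ h₀ =>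
    refine partiallyCorrect_iff.2 ?_
    rintro ρ hρ _ ⟨E, hE, F, hF, rfl⟩ A hA
    have h2 := partiallyCorrect_iff.1 h₀ _ ((isOperation_measOp M q 0).isState hρ) E hE A hA
    have h3 := partiallyCorrect_iff.1 h₁ _ ((isOperation_measOp M q 1).isState hρ) F hF A hA
    have htr := congrArg Complex.re (trace_measOp_add M q ρ)
    rw [expect_preMeas M q _ _ hρ.1]
    simp only [LinearMap.add_apply, LinearMap.comp_apply, mul_add, trace_add, Complex.add_re]
      at htr ⊢
    linarith
  | imp hΘ _ hΨ h =>
    refine partiallyCorrect_iff.2 fun ρ hρ E hE M hM => ?_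
    have hσ := (isOperation_of_mem_sem hE).isState hρ
    linarith [hΘ ρ hρ, h.expect_le hρ hE, hΨ _ hσ, expect_le hσ.1 hM]
  | union Θ Ψ _ h =>
    refine partiallyCorrect_iff.2 fun ρ hρ E hE M hM => ?_
    obtain ⟨i, hi⟩ := Set.mem_iUnion.1 hM
    exact (leInf_of_subset (Set.subset_iUnion (fun i => (Θ i).1) i) ρ hρ).trans
      (partiallyCorrect_iff.1 (h i) ρ hρ E hE M hi)
  | _ M q _ h => exact h.loop

/-! ### Weakest liberal preconditions -/

/-- `N` is the weakest liberal precondition `E†(M) + I - E†(I)` of `M` under `E`. -/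
def IsLiberalPre (E : SuperOp V) (M N : Predicate V) : Prop :=
  ∀ ρ : Op V, (N.1 * ρ).trace = (M.1 * E ρ).trace + ρ.trace - (E ρ).trace

/-- By self-duality it suffices to pair with positive `ρ`: `tr (Nρ)` is `tr (M E(ρ))` plus the lost
trace, and `tr ((I - N)ρ) = tr ((I - M) E(ρ))`. -/
theorem exists_isLiberalPre {E : SuperOp V} (hE : IsOperation E) (M : Predicate V) :
    ∃ N, IsLiberalPre E M N := by
  obtain ⟨B, hB⟩ := exists_trace_adjoint E M.1
  obtain ⟨C, hC⟩ := exists_trace_adjoint E 1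
  simp only [one_mul] at hC
  have hN (ρ : Op V) :
      ((B + 1 - C) * ρ).trace = (M.1 * E ρ).trace + ρ.trace - (E ρ).trace := by
    rw [sub_mul, add_mul, one_mul, trace_sub, trace_add, hB, hC]
  refine ⟨⟨B + 1 - C, posSemidef_of_trace_mul_nonneg fun ρ hρ => ?_,
    posSemidef_of_trace_mul_nonneg fun ρ hρ => ?_⟩, hN⟩
  · rw [hN, add_sub_assoc]
    refine add_nonneg (M.2.1.trace_mul_nonneg (hE ρ hρ).1) (Complex.le_def.2 ⟨?_, ?_⟩)
    · simpa using (hE ρ hρ).2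
    · have h1 := (Complex.le_def.1 hρ.trace_nonneg).2
      have h2 := (Complex.le_def.1 (hE ρ hρ).1.trace_nonneg).2
      rw [Complex.sub_im, ← h1, ← h2, sub_self, Complex.zero_im]
  · have h := M.2.2.trace_mul_nonneg (hE ρ hρ).1
    rw [sub_mul, one_mul, trace_sub] at h
    rw [sub_mul, one_mul, trace_sub, hN]
    exact h.trans_eq (by ring)

/-- The weakest liberal precondition `{E†(M) + I - E†(I) : E ∈ ⟦S⟧, M ∈ Ψ}`. -/
def wlp (S : Prog V) (Ψ : Assertion V) : Assertion V :=
  ⟨{N | ∃ E ∈ sem S, ∃ M ∈ Ψ.1, IsLiberalPre E M N}, by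
    obtain ⟨E, hE⟩ := sem_nonempty S
    obtain ⟨M, hM⟩ := Ψ.2
    obtain ⟨N, hN⟩ := exists_isLiberalPre (isOperation_of_mem_sem hE) M
    exact ⟨N, E, hE, M, hM, hN⟩⟩

theorem PartiallyCorrect.leInf_wlp {Θ Ψ : Assertion V} {S : Prog V}
    (h : PartiallyCorrect Θ S Ψ) : leInf Θ (wlp S Ψ) := by
  refine fun ρ hρ => le_expect ?_
  rintro N ⟨E, hE, M, hM, hN⟩
  rw [hN, Complex.sub_re, Complex.add_re]
  exact partiallyCorrect_iff.1 h ρ hρ E hE M hM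

/-! ### Completeness -/

theorem Derivable.of_subset {Θ Θ' Ψ : Assertion V} {S : Prog V} (h : Derivable Θ' S Ψ)
    (hΘ : Θ'.1 ⊆ Θ.1) : Derivable Θ S Ψ :=
  .imp (leInf_of_subset hΘ) h (leInf.refl Ψ)

/-- In (Meas) and (While) different branches could use different elements of `Ψ`, while `wlp` uses
one throughout. Fixing that element and recombining with (Union) removes the mismatch. -/
theorem derivable_wlp_of_single {S : Prog V} (Ψ : Assertion V)
    (h : ∀ M, Derivable (wlp S (.single M)) S (.single M)) : Derivable (wlp S Ψ) S Ψ := by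
  have := Ψ.2.to_subtype
  refine .imp (leInf_of_subset ?_)
    (.union (fun M : Ψ.1 => wlp S (.single M.1)) (fun M => .single M.1) fun M => h M.1)
    (leInf_of_subset fun M hM => Set.mem_iUnion.2 ⟨⟨M, hM⟩, rfl⟩)
  refine Set.iUnion_subset ?_
  rintro M N ⟨E, hE, _, rfl, hN⟩
  exact ⟨E, hE, M.1, M.2, hN⟩

theorem preMeas_subset_wlp_cond {n : ℕ} (M : Measurement n) (q : Fin n ↪ V) (S₁ S₀ : Prog V)
    (A : Predicate V) :
    (Assertion.preMeas M q (wlp S₀ (.single A)) (wlp S₁ (.single A))).1 ⊆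
      (wlp (.cond M q S₁ S₀) (.single A)).1 := by
  rintro _ ⟨N₀, ⟨E, hE, _, rfl, h₀⟩, N₁, ⟨F, hF, _, rfl, h₁⟩, rfl⟩
  refine ⟨_, ⟨E, hE, F, hF, rfl⟩, _, rfl, fun ρ => ?_⟩
  rw [trace_mul_preMeas, h₀, h₁, ← trace_measOp_add M q ρ]
  simp only [LinearMap.add_apply, LinearMap.comp_apply, mul_add, trace_add]
  ring

theorem preMeas_subset_wlp_loop {n : ℕ} (M : Measurement n) (q : Fin n ↪ V) (S : Prog V)
    (A : Predicate V) :
    (Assertion.preMeas M q (.single A) (wlp S (wlp (.loop M q S) (.single A)))).1 ⊆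
      (wlp (.loop M q S) (.single A)).1 := by
  rintro _ ⟨_, rfl, N, ⟨E, hE, N', ⟨G, ⟨η, hη, hG⟩, A, rfl, hN'⟩, hN⟩, rfl⟩
  -- Prepending `E` to the scheduler of the remaining loop gives a scheduler for the whole loop.
  obtain ⟨η', h0, hs⟩ : ∃ η' : ℕ → SuperOp V, η' 0 = E ∧ ∀ k, η' (k + 1) = η k :=
    ⟨fun k => Nat.casesOn k E η, rfl, fun _ => rfl⟩
  have hr (k : ℕ) : rounds M q η' (k + 1) = rounds M q η k ∘ₗ E ∘ₗ measOp M q 1 := by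
    rw [rounds_succ', h0, funext hs]
  refine ⟨measOp M q 0 + G ∘ₗ E ∘ₗ measOp M q 1, ⟨η', ?_, fun ρ => ?_⟩, A, rfl, ?_⟩
  · rintro (_ | k)
    exacts [h0 ▸ hE, hs k ▸ hη k]
  -- Term `0` is immediate exit; the shifted series is that of `G` after one pass through the body.
  · refine (hasSum_nat_add_iff' 1).1 ?_
    simp only [hr, Finset.sum_range_one]
    simpa [rounds] using hG (E (measOp M q 1 ρ))
  · intro ρ
    rw [trace_mul_preMeas, hN, hN', ← trace_measOp_add M q ρ]
    simp only [LinearMap.add_apply, LinearMap.comp_apply, mul_add, trace_add]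
    ring

theorem derivable_wlp (S : Prog V) (Ψ : Assertion V) : Derivable (wlp S Ψ) S Ψ := by
  induction S generalizing Ψ with
  | skip =>
    exact (Derivable.skip Ψ).of_subset fun M hM => ⟨_, rfl, M, hM, fun ρ => by simp⟩
  | abort =>
    obtain ⟨M, hM⟩ := Ψ.2
    -- For `E = 0` the liberal precondition is `I`, whatever `M` is, and `{0}` lies below every
    -- assertion.
    refine .imp (leInf_of_subset ?_) .abort fun ρ hρ => ?_
    · rintro _ rfl
      exact ⟨_, rfl, M, hM, fun ρ => by simp [Predicate.top]⟩
    · refine (expect_le hρ.1 (Set.mem_singleton _)).trans ?_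
      simpa [Predicate.bot] using expect_nonneg hρ.1 Ψ
  | setZero q =>
    refine (Derivable.init q Ψ).of_subset ?_
    rintro _ ⟨M, hM, rfl⟩
    exact ⟨_, rfl, M, hM, fun ρ => by rw [trace_mul_setZeroOp, trace_setZeroOp]; ring⟩
  | unitary q U =>
    refine (Derivable.unit q U Ψ).of_subset ?_
    rintro _ ⟨M, hM, rfl⟩
    exact ⟨_, rfl, M, hM, fun ρ => by rw [trace_mul_conjBy_unitary, trace_conjBy_unitary]; ring⟩
  | seq S₀ S₁ h₀ h₁ =>
    refine (Derivable.seq (h₀ _) (h₁ Ψ)).of_subset ?_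
    rintro N ⟨E, hE, N', ⟨F, hF, M, hM, hN'⟩, hN⟩
    refine ⟨_, ⟨E, hE, F, hF, rfl⟩, M, hM, fun ρ => ?_⟩
    rw [hN, hN', LinearMap.comp_apply]
    ring
  | choice S₀ S₁ h₀ h₁ =>
    exact .ndet ((h₀ Ψ).of_subset fun N ⟨E, hE, h⟩ => ⟨E, .inl hE, h⟩)
      ((h₁ Ψ).of_subset fun N ⟨E, hE, h⟩ => ⟨E, .inr hE, h⟩)
  | cond M q S₁ S₀ h₁ h₀ =>
    exact derivable_wlp_of_single Ψ fun A =>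
      (Derivable.meas M q (h₁ _) (h₀ _)).of_subset (preMeas_subset_wlp_cond M q S₁ S₀ A)
  | loop M q S h =>
    refine derivable_wlp_of_single Ψ fun A => ?_
    have hsub := preMeas_subset_wlp_loop M q S A
    -- (While) is used with `Θ = wlp S (wlp loop {A})`. The unrolling inclusion serves twice: to
    -- weaken the body's postcondition and to strengthen the final precondition.
    exact (Derivable.while M q (.imp (leInf.refl _) (h _) (leInf_of_subset hsub))).of_subset hsub

end NQP

theorem theorem1 {V : Type u} [Fintype V] [DecidableEq V]
    (Θ : NQP.Assertion V) (S : NQP.Prog V) (Ψ : NQP.Assertion V) :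
    (NQP.Derivable Θ S Ψ → NQP.PartiallyCorrect Θ S Ψ) ∧
      (NQP.PartiallyCorrect Θ S Ψ → NQP.Derivable Θ S Ψ) :=
  ⟨fun h => h.partiallyCorrect,
    fun h => .imp h.leInf_wlp (NQP.derivable_wlp S Ψ) (NQP.leInf.refl Ψ)⟩
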